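/- Let $\sigma$ be a permutation of $\{1,\dots,n\}$. Write each cycle of $\sigma$ (fixed points included) as $C=(c_0,c_1,\dots,c_{p-1})$ with $c_0$ its smallest element. Let $\mathrm{cyc}(\sigma)$ be the number of cycles of $\sigma$ and let $\mathrm{cdes}(\sigma)=\sum_C \bigl(1+|\{r : 0\le r\le p-2,\ c_r>c_{r+1}\}|\bigr)$, the sum being over all cycles $C$ of $\sigma$. We say that $\sigma$ has a cycle $123$-match if some cycle $(c_0,\dots,c_{p-1})$ of length $p\ge 3$ has an index $r$ with $c_r<c_{r+1}<c_{r+2}$, indices being taken modulo $p$. Let $\mathcal{NCMS}_n(123)$ be the set of permutations of $\{1,\dots,n\}$ without a cycle $123$-match, and let $$NCM_{123}(t,x,y)=\sum_{n\ge 0}\frac{t^n}{n!}\sum_{\sigma\in\mathcal{NCMS}_n(123)}x^{\mathrm{cyc}(\sigma)}y^{\mathrm{cdes}(\sigma)}.$$ Put $$D(t,y)=1+\sum_{n\ge 1}\frac{(-t)^n}{n!}\,[s^{n-1}]\,\frac{y(1-s)}{1-ys+ys^2},$$ where $[s^{m}]f(s)$ denotes the coefficient of $s^m$ in the power series $f(s)$.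 Then, for any elements $x,y$ of a commutative $\mathbb{Q}$-algebra $A$ (in particular for indeterminates $x,y$), one has in the ring $A[[t]]$ of formal power series $$NCM_{123}(t,x,y)=\exp\!\left(x\,\ln\frac{1}{D(t,y)}\right)=\left(\frac{1}{D(t,y)}\right)^{x},$$ where $\exp$ and $\ln$ are the usual formal power series, and where $F^x=\sum_{k\ge0}\frac{x(x-1)\cdots(x-k+1)}{k!}(F-1)^k$ for a power series $F$ with constant term $1$. -/

import Mathlib

open PowerSeries

namespace CycleMatch

/-- The cycles of `σ` (fixed points included) are indexed by their smallest elements: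
`cycleMins σ` is the set of all elements that are the smallest in their own cycle. -/
def cycleMins {n : ℕ} (σ : Equiv.Perm (Fin n)) : Finset (Fin n) :=
  Finset.univ.filter fun m => ∀ a, σ.SameCycle m a → m ≤ a

/-- The length of the cycle of `σ` that contains `m`. -/
def cycleLen {n : ℕ} (σ : Equiv.Perm (Fin n)) (m : Fin n) : ℕ :=
  (Finset.univ.filter fun a => σ.SameCycle m a).card

/-- The entry `c_r` of the cycle `(c_0, ..., c_{p-1})` with `c_0 = m`. Since `σ ^ p` fixes `m`, the
index `r` may be any natural number and is automatically read modulo `p`. -/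
def cycleEntry {n : ℕ} (σ : Equiv.Perm (Fin n)) (m : Fin n) (r : ℕ) : Fin n :=
  (σ ^ r) m

/-- The number of cycles of `σ`, fixed points included. -/
def cyc {n : ℕ} (σ : Equiv.Perm (Fin n)) : ℕ :=
  (cycleMins σ).card

/-- The cycle descents of the cycle `(c_0, ..., c_{p-1})` whose smallest element is `c_0 = m`:
one plus the number of `r` with `0 ≤ r`, `r + 1 ≤ p - 1` and `c_r > c_{r+1}`. -/
def cycleCdes {n : ℕ} (σ : Equiv.Perm (Fin n)) (m : Fin n) : ℕ :=
  1 + ((Finset.range (cycleLen σ m - 1)).filter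
    fun r => cycleEntry σ m (r + 1) < cycleEntry σ m r).card

/-- The cycle descents of `σ`, summed over all its cycles. -/
def cdes {n : ℕ} (σ : Equiv.Perm (Fin n)) : ℕ :=
  ∑ m ∈ cycleMins σ, cycleCdes σ m

/-- `red(w) = τ`: the word `w` of distinct entries has the same relative order as the one-line
word `τ_1 ... τ_j`. -/
def RedEq {n j : ℕ} (w : Fin j → Fin n) (τ : Equiv.Perm (Fin j)) : Prop :=
  ∀ a b : Fin j, w a < w b ↔ τ a < τ b

instance {n j : ℕ} (w : Fin j → Fin n) (τ : Equiv.Perm (Fin j)) : Decidable (RedEq w τ) := by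
  unfold RedEq; infer_instance

/-- `σ` has a cycle `τ`-match: some cycle `(c_0, ..., c_{p-1})` with `p ≥ j` has an index `r` with
`red(c_r c_{r+1} ... c_{r+j-1}) = τ`, indices being read modulo `p`. -/
def HasCycleMatch {n j : ℕ} (τ : Equiv.Perm (Fin j)) (σ : Equiv.Perm (Fin n)) : Prop :=
  ∃ m ∈ cycleMins σ, j ≤ cycleLen σ m ∧
    ∃ r ∈ Finset.range (cycleLen σ m), RedEq (fun s : Fin j => cycleEntry σ m (r + s)) τ

instance {n j : ℕ} (τ : Equiv.Perm (Fin j)) (σ : Equiv.Perm (Fin n)) :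
    Decidable (HasCycleMatch τ σ) := by
  unfold HasCycleMatch; infer_instance

/-- The permutations of `n` letters without cycle `τ`-matches. -/
def NCMS {j : ℕ} (n : ℕ) (τ : Equiv.Perm (Fin j)) : Finset (Equiv.Perm (Fin n)) :=
  Finset.univ.filter fun σ => ¬ HasCycleMatch τ σ

/-- The exponential generating function `NCM_τ(t, x, y)`, a power series in `t`. -/
noncomputable def NCM {A : Type*} [CommRing A] [Algebra ℚ A] {j : ℕ} (τ : Equiv.Perm (Fin j))
    (x y : A) : A⟦X⟧ :=
  PowerSeries.mk fun n =>
    algebraMap ℚ A (1 / (n.factorial : ℚ)) * ∑ σ ∈ NCMS n τ, x ^ cyc σ * y ^ cdes σ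

/-- The pattern `123`: the identity of three letters. -/
def pattern123 : Equiv.Perm (Fin 3) := 1

/-- The rational power series `y (1 - t) / (1 - y t + y t ^ 2)`; the denominator has constant
coefficient `1`, so that `invOfUnit _ 1` is its inverse. -/
noncomputable def wordSeries {A : Type*} [CommRing A] (y : A) : A⟦X⟧ :=
  C y * (1 - X) * invOfUnit (1 - C y * X + C y * X ^ 2) 1

/-- The series `1 + ∑_{n ≥ 1} ((-t) ^ n / n!) [s ^ (n - 1)] (y (1 - s) / (1 - y s + y s ^ 2))`. -/
noncomputable def denomSeries {A : Type*} [CommRing A] [Algebra ℚ A] (y : A) : A⟦X⟧ :=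
  1 + PowerSeries.mk fun n =>
    if n = 0 then 0
    else algebraMap ℚ A ((-1) ^ n / (n.factorial : ℚ)) * coeff (n - 1) (wordSeries y)

/-- `exp (f)` for a power series `f` without constant term. -/
noncomputable def expOf {A : Type*} [CommRing A] [Algebra ℚ A] (f : A⟦X⟧) : A⟦X⟧ :=
  (PowerSeries.exp A).subst f

/-- The power `f ^ x = ∑_k (x (x - 1) ... (x - k + 1) / k!) (f - 1) ^ k` of a power series `f` with
constant coefficient `1` (the generalized binomial series, evaluated at `f - 1`). -/
noncomputable def powOf {A : Type*} [CommRing A] [Algebra ℚ A] (f : A⟦X⟧) (x : A) : A⟦X⟧ :=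
  (PowerSeries.mk fun k =>
    algebraMap ℚ A (1 / (k.factorial : ℚ)) * ∏ i ∈ Finset.range k, (x - (i : A))).subst (f - 1)

end CycleMatch

/-! Write `D` for `denomSeries y` and `L = -D'/D` for the logarithmic derivative of `1/D`. Both `exp
(x ln (1/D))` and `(1/D)^x` have constant term `1` and satisfy `G' = x L G`. On coefficients of
exponential series this equation is a recursion, so it suffices that the permutation sums satisfy
the same recursion.

Read the cycle of the smallest letter `m` as a word beginning with `m`. A match cannot wrap around
its end, since no ascent leads into `m`; the cycle is match-free exactly when the word has no two
consecutive ascents. Removing it leaves an arbitrary permutation of the unused letters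
(`permSum_eq_pathSum`), and the claim becomes that `y` times the words beginning with their minimum,
weighted by `y^des`, are counted by `L` (`mul_pathSum_empty`).

That count follows from a cancellation in `pathSum_denomCoeff`: when the unused letters are weighted
by the coefficients of `D`, the sum over words collapses to a closed form. Read as a subset
convolution, this says `D L = -D'`. -/

namespace CycleMatch

/-! ### Exponential coefficients and the differential equation `G' = x L G` -/

section Series

variable {A : Type*} [CommRing A]

/-- The number `n! * [t ^ n] f`, the `n`-th coefficient of `f` as an exponential series. -/
noncomputable def egfCoeff (f : A⟦X⟧) (n : ℕ) : A := (n.factorial : A) * coeff n f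

theorem egfCoeff_zero (f : A⟦X⟧) : egfCoeff f 0 = constantCoeff f := by
  simp [egfCoeff]

theorem egfCoeff_derivative (f : A⟦X⟧) (n : ℕ) :
    egfCoeff (derivative A f) n = egfCoeff f (n + 1) := by
  simp only [egfCoeff, coeff_derivative, Nat.factorial_succ]
  push_cast
  ring

theorem egfCoeff_C_mul (a : A) (f : A⟦X⟧) (n : ℕ) :
    egfCoeff (C a * f) n = a * egfCoeff f n := by
  simp only [egfCoeff, coeff_C_mul]
  ring

theorem egfCoeff_mul (f g : A⟦X⟧) (n : ℕ) :
    egfCoeff (f * g) n =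
      ∑ k ∈ Finset.range (n + 1), (n.choose k : A) * (egfCoeff f k * egfCoeff g (n - k)) := by
  rw [egfCoeff, coeff_mul, Finset.Nat.sum_antidiagonal_eq_sum_range_succ
    (fun i j => coeff i f * coeff j g), Finset.mul_sum]
  refine Finset.sum_congr rfl fun k hk => ?_
  have h := Nat.choose_mul_factorial_mul_factorial (Nat.lt_succ_iff.mp (Finset.mem_range.mp hk))
  rw [← h, egfCoeff, egfCoeff]
  push_cast
  ring

/-- Links sums over subsets to products of series: the number of `T ⊆ S` of size `k` is the binomial
coefficient in `egfCoeff_mul`. -/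
theorem sum_powerset_egfCoeff {α : Type*} [DecidableEq α] (f g : A⟦X⟧) (S : Finset α) :
    ∑ T ∈ S.powerset, egfCoeff f T.card * egfCoeff g (S \ T).card = egfCoeff (f * g) S.card := by
  rw [egfCoeff_mul, ← Finset.sum_congr rfl fun k _ => nsmul_eq_mul _ _,
    ← Finset.sum_powerset_apply_card]
  refine Finset.sum_congr rfl fun T hT => ?_
  rw [Finset.card_sdiff_of_subset (Finset.mem_powerset.mp hT)]

theorem wordSeries_mul (y : A) :
    wordSeries y * (1 - C y * X + C y * X ^ 2) = C y * (1 - X) := by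
  have h : (1 - C y * X + C y * X ^ 2) * invOfUnit (1 - C y * X + C y * X ^ 2) 1 = 1 :=
    mul_invOfUnit _ _ (by simp)
  rw [wordSeries, mul_assoc, mul_comm (invOfUnit _ _), h, mul_one]

theorem coeff_wordSeries_zero (y : A) : coeff 0 (wordSeries y) = y := by
  simpa using congrArg (coeff 0) (wordSeries_mul y)

theorem coeff_wordSeries_one (y : A) : coeff 1 (wordSeries y) = y * y - y := by
  have h := congrArg (coeff 1) (wordSeries_mul y)
  have e : wordSeries y * (1 - C y * X + C y * X ^ 2) =
    wordSeries y - C y * (wordSeries y * X) + C y * ((wordSeries y * X) * X) := by ring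
  rw [e, mul_sub, mul_one] at h
  simp only [map_add, map_sub, coeff_C_mul, coeff_succ_mul_X, coeff_C,
    coeff_zero_mul_X, coeff_wordSeries_zero] at h
  simp at h
  linear_combination h

theorem coeff_wordSeries_add_two (y : A) (n : ℕ) :
    coeff (n + 2) (wordSeries y) =
      y * coeff (n + 1) (wordSeries y) - y * coeff n (wordSeries y) := by
  have h := congrArg (coeff (n + 2)) (wordSeries_mul y)
  have e : wordSeries y * (1 - C y * X + C y * X ^ 2) =
    wordSeries y - C y * (wordSeries y * X) + C y * ((wordSeries y * X) * X) := by ring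
  rw [e, mul_sub, mul_one] at h
  simp only [map_add, map_sub, coeff_C_mul, coeff_succ_mul_X, coeff_C] at h
  simp at h
  linear_combination h

theorem one_add_X_subst {g : A⟦X⟧} (hg : constantCoeff g = 1) :
    (1 + X : A⟦X⟧).subst (g - 1) = g := by
  have h : HasSubst (g - 1) := HasSubst.of_constantCoeff_zero' (by simp [hg])
  rw [← coe_substAlgHom h, map_add, map_one, coe_substAlgHom h, subst_X h]
  ring

/-- The coefficients of `denomSeries y` as an exponential series. -/
def denomCoeff (y : A) : ℕ → A
  | 0 => 1
  | 1 => -y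
  | n + 2 => -(y * (denomCoeff y (n + 1) + denomCoeff y n))

theorem denomCoeff_succ (y : A) : ∀ n,
    denomCoeff y (n + 1) = (-1) ^ (n + 1) * coeff n (wordSeries y)
  | 0 => by rw [coeff_wordSeries_zero, denomCoeff]; ring
  | 1 => by rw [coeff_wordSeries_one, denomCoeff, denomCoeff, denomCoeff]; ring
  | n + 2 => by
    rw [coeff_wordSeries_add_two, denomCoeff, denomCoeff_succ y (n + 1), denomCoeff_succ y n]
    ring

theorem constantCoeff_subst_of_zero (f : A⟦X⟧) {g : A⟦X⟧} (hg : constantCoeff g = 0) :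
    constantCoeff (f.subst g) = constantCoeff f := by
  have h : HasSubst g := HasSubst.of_constantCoeff_zero' hg
  have h1 : constantCoeff ((f - C (constantCoeff f)).subst g) = 0 :=
    constantCoeff_subst_eq_zero hg _ (by simp)
  rw [← coe_substAlgHom h, map_sub, coe_substAlgHom h, subst_C, map_sub, sub_eq_zero] at h1
  exact h1.trans (constantCoeff_C _)

variable [Algebra ℚ A]

theorem egfCoeff_mk (u : ℕ → A) (n : ℕ) :
    egfCoeff (mk fun n => algebraMap ℚ A (1 / (n.factorial : ℚ)) * u n) n = u n := by
  have h : (n.factorial : ℚ) ≠ 0 := by positivity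
  rw [egfCoeff, coeff_mk, ← mul_assoc, ← map_natCast (algebraMap ℚ A), ← map_mul,
    mul_one_div_cancel h, map_one, one_mul]

theorem egfCoeff_injective : Function.Injective (egfCoeff : A⟦X⟧ → ℕ → A) := by
  intro f g h
  ext n
  have h0 : (n.factorial : ℚ) ≠ 0 := by positivity
  have h1 := congrArg (algebraMap ℚ A (1 / (n.factorial : ℚ)) * ·) (congrFun h n)
  simpa only [egfCoeff, ← mul_assoc, ← map_natCast (algebraMap ℚ A), ← map_mul,
    one_div_mul_cancel h0, map_one, one_mul] using h1

theorem denomSeries_eq_mk (y : A) :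
    denomSeries y = mk fun n => algebraMap ℚ A (1 / (n.factorial : ℚ)) * denomCoeff y n := by
  ext n
  cases n with
  | zero => simp [denomSeries, denomCoeff]
  | succ n =>
    have h : ((-1) ^ (n + 1) / ((n + 1).factorial : ℚ)) =
      1 / ((n + 1).factorial : ℚ) * (-1) ^ (n + 1) := by ring
    simp only [denomSeries, map_add, coeff_one, coeff_mk, if_neg n.succ_ne_zero, zero_add,
      denomCoeff_succ, Nat.add_sub_cancel, h, map_mul, map_pow, map_neg, map_one, mul_assoc]

theorem egfCoeff_denomSeries (y : A) (n : ℕ) : egfCoeff (denomSeries y) n = denomCoeff y n := by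
  rw [denomSeries_eq_mk, egfCoeff_mk]

theorem constantCoeff_denomSeries (y : A) : constantCoeff (denomSeries y) = 1 := by
  rw [← egfCoeff_zero, egfCoeff_denomSeries, denomCoeff]

/-- The reciprocal of `denomSeries y`. -/
noncomputable abbrev recipSeries (y : A) : A⟦X⟧ := invOfUnit (denomSeries y) 1

theorem denomSeries_mul_recipSeries (y : A) : denomSeries y * recipSeries y = 1 :=
  mul_invOfUnit _ _ (by simp [constantCoeff_denomSeries])

theorem constantCoeff_recipSeries (y : A) : constantCoeff (recipSeries y) = 1 := by
  simp [recipSeries]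

/-- The logarithmic derivative of `recipSeries y`. -/
noncomputable def logDerivSeries (y : A) : A⟦X⟧ :=
  -derivative A (denomSeries y) * recipSeries y

theorem derivative_recipSeries (y : A) :
    derivative A (recipSeries y) = logDerivSeries y * recipSeries y := by
  have h := denomSeries_mul_recipSeries y
  have h1 := congrArg (derivative A) h
  rw [Derivation.leibniz, derivative_one, smul_eq_mul, smul_eq_mul] at h1
  rw [logDerivSeries]
  linear_combination recipSeries y * h1 - derivative A (recipSeries y) * h

theorem derivative_log_mul : derivative A (log A) * (1 + X) = 1 := by
  rw [deriv_log]
  ext n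
  cases n with
  | zero => simp
  | succ n =>
    rw [mul_add, mul_one, map_add, coeff_succ_mul_X, coeff_mk, coeff_mk, coeff_one,
      if_neg n.succ_ne_zero, ← map_add, pow_succ]
    simp

theorem constantCoeff_expOf {f : A⟦X⟧} (hf : constantCoeff f = 0) :
    constantCoeff (expOf f) = 1 := by
  rw [expOf, constantCoeff_subst_of_zero _ hf, constantCoeff_exp]

theorem derivative_expOf {f : A⟦X⟧} (hf : constantCoeff f = 0) :
    derivative A (expOf f) = derivative A f * expOf f := by
  rw [expOf, derivative_subst (HasSubst.of_constantCoeff_zero' hf), derivative_exp, mul_comm]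

theorem derivative_logOf_mul {g : A⟦X⟧} (hg : constantCoeff g = 1) :
    derivative A (logOf g) * g = derivative A g := by
  have h : HasSubst (g - 1) := HasSubst.of_constantCoeff_zero' (by simp [hg])
  have h1 := congrArg (subst (g - 1)) (derivative_log_mul (A := A))
  rw [subst_mul h, one_add_X_subst hg, ← coe_substAlgHom h, map_one, coe_substAlgHom h] at h1
  rw [logOf, derivative_subst h, map_sub, derivative_one, sub_zero]
  linear_combination derivative A g * h1

/-- The generalized binomial series `(1 + t) ^ x`. -/
noncomputable def powSeries (x : A) : A⟦X⟧ :=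
  mk fun k => algebraMap ℚ A (1 / (k.factorial : ℚ)) * ∏ i ∈ Finset.range k, (x - (i : A))

/-- With `p_n = x (x - 1) ... (x - n + 1)`, comparing coefficients gives `p_{n+1} + n p_n = x p_n`.
-/
theorem derivative_powSeries_mul (x : A) :
    derivative A (powSeries x) * (1 + X) = C x * powSeries x := by
  apply egfCoeff_injective
  ext n
  have h (n : ℕ) : egfCoeff (powSeries x) n = ∏ i ∈ Finset.range n, (x - (i : A)) :=
    egfCoeff_mk _ n
  have hX (f : A⟦X⟧) : egfCoeff (f * X) n = n * egfCoeff f (n - 1) := by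
    cases n with
    | zero => simp [egfCoeff]
    | succ n =>
      simp only [egfCoeff, coeff_succ_mul_X, Nat.factorial_succ, Nat.add_sub_cancel]
      push_cast
      ring
  have e : egfCoeff (derivative A (powSeries x) * (1 + X)) n =
      egfCoeff (derivative A (powSeries x)) n + egfCoeff (derivative A (powSeries x) * X) n := by
    rw [egfCoeff, egfCoeff, egfCoeff, mul_add, mul_one, map_add, mul_add]
  rw [e, hX, egfCoeff_C_mul, egfCoeff_derivative, egfCoeff_derivative, h, h,
    Finset.prod_range_succ]
  cases n with
  | zero => simp [h]
  | succ n =>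
    rw [Nat.add_sub_cancel, h]
    ring

theorem constantCoeff_powOf {g : A⟦X⟧} (hg : constantCoeff g = 1) (x : A) :
    constantCoeff (powOf g x) = 1 := by
  rw [powOf, constantCoeff_subst_of_zero _ (by simp [hg]), ← coeff_zero_eq_constantCoeff_apply]
  simp

theorem derivative_powOf_mul {g : A⟦X⟧} (hg : constantCoeff g = 1) (x : A) :
    derivative A (powOf g x) * g = C x * derivative A g * powOf g x := by
  have h : HasSubst (g - 1) := HasSubst.of_constantCoeff_zero' (by simp [hg])
  have h1 := congrArg (subst (g - 1)) (derivative_powSeries_mul x)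
  rw [subst_mul h, one_add_X_subst hg, subst_mul h, subst_C] at h1
  change _ = C x * _ at h1
  have e : powOf g x = (powSeries x).subst (g - 1) := rfl
  rw [e, derivative_subst h, map_sub, derivative_one, sub_zero]
  linear_combination derivative A g * h1

theorem derivative_expOf_log (x y : A) :
    derivative A (expOf (C x * logOf (recipSeries y))) =
      C x * logDerivSeries y * expOf (C x * logOf (recipSeries y)) := by
  have hr := constantCoeff_recipSeries y
  have h := derivative_logOf_mul hr
  rw [derivative_recipSeries] at h
  have h2 : derivative A (logOf (recipSeries y)) = logDerivSeries y := by
    -- Multiplication by `denomSeries y` cancels the factor `recipSeries y` on both sides of `h`.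
    linear_combination denomSeries y * h - (derivative A (logOf (recipSeries y)) -
      logDerivSeries y) * denomSeries_mul_recipSeries y
  rw [derivative_expOf (by simp [constantCoeff_logOf hr]), Derivation.leibniz, derivative_C, h2]
  simp

theorem derivative_powOf_recipSeries (x y : A) :
    derivative A (powOf (recipSeries y) x) =
      C x * logDerivSeries y * powOf (recipSeries y) x := by
  have h := derivative_powOf_mul (constantCoeff_recipSeries y) x
  rw [derivative_recipSeries] at h
  linear_combination denomSeries y * h - (derivative A (powOf (recipSeries y) x) -
    C x * logDerivSeries y * powOf (recipSeries y) x) * denomSeries_mul_recipSeries y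

end Series

/-! ### Words without double ascents, built letter by letter -/

section PathSum

variable {A : Type*} [CommRing A] {α : Type*} [LinearOrder α]

/-- The weighted sum over the words `w` without repetition and with letters in `S` such that the
word `b w` has no two consecutive ascents, and, if `asc` holds, such that `w` does not begin with
an ascent from `b`. A word has weight `y` to the number of descents of `b w`, times the value
of `u` at the set of the letters that are not used. -/
def pathSum (y : A) (u : Finset α → A) (S : Finset α) (b : α) (asc : Bool) : A :=
  u S + ∑ a ∈ S.attach,
    if a.1 < b then y * pathSum y u (S.erase a.1) a.1 false
    else if asc then 0 else pathSum y u (S.erase a.1) a.1 true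
termination_by S.card
decreasing_by all_goals exact Finset.card_erase_lt_of_mem a.2

/-- The contribution to `pathSum` of the words with first letter `a`. -/
def pathStep (y : A) (u : Finset α → A) (S : Finset α) (b : α) (asc : Bool) (a : α) : A :=
  if a < b then y * pathSum y u S a false else if asc then 0 else pathSum y u S a true

theorem pathSum_eq (y : A) (u : Finset α → A) (S : Finset α) (b : α) (asc : Bool) :
    pathSum y u S b asc = u S + ∑ a ∈ S, pathStep y u (S.erase a) b asc a := by
  rw [pathSum, ← Finset.sum_attach S]
  rfl

/-- Only subsets of `S` remain as sets of unused letters; this lets an inductive hypothesis on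
smaller sets be substituted for `u`. -/
theorem pathSum_congr (y : A) {u v : Finset α → A} (S : Finset α) (b : α) (asc : Bool)
    (h : ∀ T ⊆ S, u T = v T) : pathSum y u S b asc = pathSum y v S b asc := by
  induction S using Finset.strongInduction generalizing b asc with
  | H S ih =>
    rw [pathSum_eq, pathSum_eq, h S (Finset.Subset.refl S)]
    congr 1
    refine Finset.sum_congr rfl fun a ha => ?_
    have e := ih _ (Finset.erase_ssubset ha) a
    have hT : ∀ T ⊆ S.erase a, u T = v T := fun T hT => h T (hT.trans (Finset.erase_subset a S))
    rw [pathStep, pathStep, e false hT, e true hT]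

/-- Reserving a set `T` before the word is chosen, or picking `T` among the letters it leaves
unused, gives the same pairs. In the induction the choices of `T` and of a first letter `a ∉ T` are
exchanged. -/
theorem sum_powerset_pathSum (y : A) (u v : Finset α → A) (S : Finset α) (b : α) (asc : Bool) :
    ∑ T ∈ S.powerset, v T * pathSum y u (S \ T) b asc =
      pathSum y (fun S => ∑ T ∈ S.powerset, v T * u (S \ T)) S b asc := by
  induction S using Finset.strongInduction generalizing b asc with
  | H S ih =>
    rw [pathSum_eq]
    simp only [pathSum_eq y u, mul_add, Finset.sum_add_distrib, Finset.mul_sum]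
    congr 1
    rw [Finset.sum_comm' (t' := S) (s' := fun a => (S.erase a).powerset)]
    · refine Finset.sum_congr rfl fun a ha => ?_
      have e (T : Finset α) : (S \ T).erase a = S.erase a \ T := by
        ext z; simp only [Finset.mem_erase, Finset.mem_sdiff]; tauto
      have h := ih _ (Finset.erase_ssubset ha) a
      simp only [e, pathStep]
      split_ifs
      · rw [← h, Finset.mul_sum]
        exact Finset.sum_congr rfl fun T _ => by ring
      · simp
      · exact h true
    · intro T a
      simp only [Finset.mem_powerset, Finset.mem_sdiff, Finset.subset_erase]
      tauto

theorem sum_ite_forall_erase_lt (S : Finset α) (hS : S.Nonempty) (f : α → A) :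
    (∑ a ∈ S, if ∀ z ∈ S.erase a, a < z then f a else 0) = f (S.min' hS) := by
  rw [Finset.sum_eq_single_of_mem _ (S.min'_mem hS), if_pos]
  · exact fun z hz => S.min'_lt_of_mem_erase_min' hS hz
  · intro a ha hne
    refine if_neg fun h => ?_
    have h1 := h _ (Finset.mem_erase.mpr ⟨hne.symm, S.min'_mem hS⟩)
    exact absurd (S.min'_le a ha) (not_le.mpr h1)

/-- The value of `∑ T ⊆ S, denomCoeff y #T * H (S \ T)`, where `H` sums the weights of all words
that begin below all their other letters, in terms of the number of letters of `S`. -/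
def startCoeff (y : A) : ℕ → A
  | 0 => 1
  | n + 1 => denomCoeff y (n + 1) + denomCoeff y n

theorem mul_startCoeff (y : A) : ∀ n, y * startCoeff y n = -denomCoeff y (n + 1)
  | 0 => by simp [startCoeff, denomCoeff]
  | n + 1 => by rw [startCoeff, denomCoeff]; ring

/-- By induction only the first letter `a = min S` contributes. If `a < b`, its term `y * startCoeff
y n` is exactly `-denomCoeff y (n + 1)` and cancels the empty word. If `b < a`, its term is `0` or
`denomCoeff y n` according to `asc`, and nothing cancels. -/
theorem pathSum_denomCoeff (y : A) (S : Finset α) (b : α) (hb : b ∉ S) (asc : Bool) :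
    pathSum y (fun T => denomCoeff y T.card) S b asc =
      if ∀ z ∈ S, b < z then if asc then denomCoeff y S.card else startCoeff y S.card else 0 := by
  induction S using Finset.strongInduction generalizing b asc with
  | H S ih =>
    rw [pathSum_eq]
    rcases S.eq_empty_or_nonempty with rfl | hS
    · simp [startCoeff, denomCoeff]
    obtain ⟨n, hn⟩ : ∃ n, S.card = n + 1 :=
      Nat.exists_eq_succ_of_ne_zero (Finset.card_ne_zero.mpr hS)
    have e : ∀ a ∈ S, pathStep y (fun T => denomCoeff y T.card) (S.erase a) b asc a =
        if ∀ z ∈ S.erase a, a < z then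
          if a < b then -denomCoeff y (n + 1) else if asc then 0 else denomCoeff y n
        else 0 := by
      intro a ha
      have hc : (S.erase a).card = n := by rw [Finset.card_erase_of_mem ha, hn]; rfl
      have h := ih _ (Finset.erase_ssubset ha) a (Finset.notMem_erase a S)
      rw [pathStep, h, h, hc, mul_ite, mul_zero]
      simp only [Bool.false_eq_true, if_false, if_true, mul_startCoeff]
      split_ifs <;> rfl
    rw [Finset.sum_congr rfl e, sum_ite_forall_erase_lt S hS, hn, startCoeff]
    -- Since `b ∉ S`, the letter `b` is either below all of `S` or above `min S`.
    have hm : (∀ z ∈ S, b < z) ↔ ¬ S.min' hS < b := by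
      rw [not_lt]
      constructor
      · exact fun h => (h _ (S.min'_mem hS)).le
      · intro h z hz
        exact lt_of_le_of_ne (h.trans (S.min'_le z hz)) fun hbz => hb (hbz ▸ hz)
    simp only [hm]
    split_ifs <;> ring

end PathSum

/-- The indicator of `∅` is the unit of subset convolution. -/
theorem sum_powerset_mul_ite_eq_empty {A α : Type*} [CommRing A] [DecidableEq α]
    (v : Finset α → A) (S : Finset α) :
    (∑ T ∈ S.powerset, v T * if S \ T = ∅ then (1 : A) else 0) = v S := by
  rw [Finset.sum_eq_single_of_mem S (Finset.mem_powerset_self S)]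
  · simp
  · intro T hT hne
    rw [if_neg, mul_zero]
    rw [Finset.sdiff_eq_empty_iff_subset]
    exact fun h => hne (Finset.Subset.antisymm (Finset.mem_powerset.mp hT) h)

/-! ### Words beginning with their minimum are counted by `L` -/

section PathSumEmpty

variable {A : Type*} [CommRing A] [Algebra ℚ A] {α : Type*} [LinearOrder α]

/-- The indicator weight forces the word to use every letter of `S`. Convolved with the coefficients
of `D`, both sides give those of `-D'`: the left by `pathSum_denomCoeff` and `mul_startCoeff`, the
right because `D L = -D'`. -/
theorem mul_pathSum_empty (y : A) (S : Finset α) (b : α) (hb : ∀ z ∈ S, b < z) :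
    y * pathSum y (fun T => if T = ∅ then 1 else 0) S b false =
      egfCoeff (logDerivSeries y) S.card := by
  induction S using Finset.strongInduction with
  | H S ih =>
    have h1 := sum_powerset_pathSum y (fun T => if T = ∅ then 1 else 0)
      (fun T => denomCoeff y T.card) S b false
    simp only [sum_powerset_mul_ite_eq_empty fun T : Finset α => denomCoeff y T.card] at h1
    rw [pathSum_denomCoeff y S b (fun h => lt_irrefl _ (hb _ h)), if_pos hb,
      if_neg Bool.false_ne_true] at h1
    have h2 := sum_powerset_egfCoeff (denomSeries y) (logDerivSeries y) S
    have h3 : denomSeries y * logDerivSeries y = C (-1) * derivative A (denomSeries y) := by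
      rw [logDerivSeries, map_neg, map_one]
      linear_combination -derivative A (denomSeries y) * denomSeries_mul_recipSeries y
    rw [h3, egfCoeff_C_mul, egfCoeff_derivative, egfCoeff_denomSeries, neg_one_mul,
      ← mul_startCoeff, ← h1, Finset.mul_sum] at h2
    -- The term `T = ∅` carries the coefficient `denomCoeff y 0 = 1` and is the claim for `S`; all
    -- other terms agree by induction.
    have hS : (∅ : Finset α) ∈ S.powerset := Finset.empty_mem_powerset S
    rw [← Finset.add_sum_erase _ _ hS, ← Finset.add_sum_erase _ _ hS] at h2
    have h4 : ∀ T ∈ S.powerset.erase ∅,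
        egfCoeff (denomSeries y) T.card * egfCoeff (logDerivSeries y) (S \ T).card =
        y * (denomCoeff y T.card *
          pathSum y (fun T => if T = ∅ then 1 else 0) (S \ T) b false) := by
      intro T hT
      rw [Finset.mem_erase, Finset.mem_powerset] at hT
      rw [← ih (S \ T) (Finset.sdiff_ssubset hT.2 (Finset.nonempty_iff_ne_empty.mpr hT.1))
        fun z hz => hb z (Finset.sdiff_subset hz), egfCoeff_denomSeries]
      ring
    rw [Finset.sum_congr rfl h4, add_left_inj] at h2
    simpa [egfCoeff_denomSeries, denomCoeff] using h2.symm

theorem mul_pathSum_egfCoeff (y : A) (G : A⟦X⟧) (S : Finset α) (b : α) (hb : ∀ z ∈ S, b < z) :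
    y * pathSum y (fun T => egfCoeff G T.card) S b false =
      egfCoeff (logDerivSeries y * G) S.card := by
  have h1 := sum_powerset_pathSum y (fun T => if T = ∅ then 1 else 0)
    (fun T => egfCoeff G T.card) S b false
  simp only [sum_powerset_mul_ite_eq_empty fun T : Finset α => egfCoeff G T.card] at h1
  rw [← h1, mul_comm _ G, ← sum_powerset_egfCoeff, Finset.mul_sum]
  refine Finset.sum_congr rfl fun T _ => ?_
  rw [← mul_pathSum_empty y (S \ T) b fun z hz => hb z (Finset.sdiff_subset hz)]
  ring

end PathSumEmpty

/-! ### Cycles under insertion of a fixed point -/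

section Cycles

variable {n : ℕ}

theorem sameCycle_induction {σ : Equiv.Perm (Fin n)} {P : Fin n → Prop} {a z : Fin n}
    (h : σ.SameCycle a z) (ha : P a) (hσ : ∀ z, P z → P (σ z)) : P z := by
  obtain ⟨i, rfl⟩ := h.exists_nat_pow_eq
  clear h
  induction i with
  | zero => exact ha
  | succ i ih => rw [pow_succ', Equiv.Perm.mul_apply]; exact hσ _ ih

theorem pow_apply_eq_of_invariant {σ τ : Equiv.Perm (Fin n)} {P : Fin n → Prop}
    (hσ : ∀ z, P z → P (σ z)) (hτ : ∀ z, P z → τ z = σ z) {a : Fin n} (ha : P a) (i : ℕ) :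
    P ((σ ^ i) a) ∧ (τ ^ i) a = (σ ^ i) a := by
  induction i with
  | zero => exact ⟨ha, rfl⟩
  | succ i ih =>
    rw [pow_succ', pow_succ', Equiv.Perm.mul_apply, Equiv.Perm.mul_apply, ih.2]
    exact ⟨hσ _ ih.1, hτ _ ih.1⟩

theorem sameCycle_iff_of_invariant {σ τ : Equiv.Perm (Fin n)} {P : Fin n → Prop}
    (hσ : ∀ z, P z → P (σ z)) (hτ : ∀ z, P z → τ z = σ z) {a : Fin n} (ha : P a) (z : Fin n) :
    τ.SameCycle a z ↔ σ.SameCycle a z := by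
  constructor
  · intro h
    obtain ⟨i, rfl⟩ := h.exists_nat_pow_eq
    exact ⟨i, by rw [zpow_natCast, (pow_apply_eq_of_invariant hσ hτ ha i).2]⟩
  · intro h
    obtain ⟨i, rfl⟩ := h.exists_nat_pow_eq
    exact ⟨i, by rw [zpow_natCast, (pow_apply_eq_of_invariant hσ hτ ha i).2]⟩

theorem cycleLen_eq_minimalPeriod (σ : Equiv.Perm (Fin n)) (m : Fin n) :
    cycleLen σ m = Function.minimalPeriod σ m := by
  have hpos : 0 < Function.minimalPeriod σ m :=
    Function.minimalPeriod_pos_of_mem_periodicPts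
      (Function.Injective.mem_periodicPts σ.injective m)
  have h : (Finset.univ.filter fun a => σ.SameCycle m a) =
      (Finset.range (Function.minimalPeriod σ m)).image fun i => σ^[i] m := by
    ext a
    simp only [Finset.mem_filter, Finset.mem_univ, true_and, Finset.mem_image, Finset.mem_range]
    constructor
    · intro h
      obtain ⟨i, rfl⟩ := h.exists_nat_pow_eq
      exact ⟨i % Function.minimalPeriod σ m, Nat.mod_lt _ hpos, by
        rw [Function.iterate_mod_minimalPeriod_eq, Equiv.Perm.iterate_eq_pow]⟩
    · rintro ⟨i, -, rfl⟩
      exact ⟨i, by rw [zpow_natCast, Equiv.Perm.iterate_eq_pow]⟩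
  rw [cycleLen, h, Finset.card_image_of_injOn, Finset.card_range]
  intro i hi j hj hij
  exact (Function.iterate_injOn_Iio_minimalPeriod (f := σ) (x := m)) (by simpa using hi)
    (by simpa using hj) hij

theorem cycleEntry_cycleLen (σ : Equiv.Perm (Fin n)) (m : Fin n) :
    cycleEntry σ m (cycleLen σ m) = m := by
  rw [cycleEntry, cycleLen_eq_minimalPeriod, ← Equiv.Perm.iterate_eq_pow]
  exact Function.iterate_minimalPeriod

theorem cycleEntry_ne (σ : Equiv.Perm (Fin n)) (m : Fin n) {i j : ℕ}
    (hij : i < j) (hj : j < cycleLen σ m) : cycleEntry σ m i ≠ cycleEntry σ m j := by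
  rw [cycleLen_eq_minimalPeriod] at hj
  rw [cycleEntry, cycleEntry, ← Equiv.Perm.iterate_eq_pow, ← Equiv.Perm.iterate_eq_pow]
  intro h
  exact hij.ne (Function.iterate_injOn_Iio_minimalPeriod (f := σ) (x := m)
    (Set.mem_Iio.mpr (hij.trans hj)) (Set.mem_Iio.mpr hj) h)

theorem cycleLen_pos (σ : Equiv.Perm (Fin n)) (m : Fin n) : 0 < cycleLen σ m :=
  Finset.card_pos.mpr ⟨m, by simp [Equiv.Perm.SameCycle.refl]⟩

theorem sameCycle_cycleEntry (σ : Equiv.Perm (Fin n)) (m : Fin n) (i : ℕ) :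
    σ.SameCycle m (cycleEntry σ m i) :=
  ⟨i, by rw [zpow_natCast, cycleEntry]⟩

/-- If `σ` fixes `b`, then `swap b a * σ` arises from `σ` by inserting `b` before `a` in the cycle
of `a`; all other images are unchanged. -/
theorem swap_mul_apply_of_ne {σ : Equiv.Perm (Fin n)} {a b : Fin n} (hb : σ b = b)
    {z : Fin n} (hz : z ≠ b) (hza : σ z ≠ a) : (Equiv.swap b a * σ) z = σ z := by
  rw [Equiv.Perm.mul_apply]
  exact Equiv.swap_apply_of_ne_of_ne (fun h => hz (σ.injective (h.trans hb.symm))) hza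

theorem sameCycle_swap_mul {σ : Equiv.Perm (Fin n)} {a b : Fin n} (hb : σ b = b) (z : Fin n) :
    (Equiv.swap b a * σ).SameCycle b z ↔ z = b ∨ σ.SameCycle a z := by
  have hba : (Equiv.swap b a * σ) b = a := by
    rw [Equiv.Perm.mul_apply, hb, Equiv.swap_apply_left]
  constructor
  · intro h
    refine sameCycle_induction (P := fun z => z = b ∨ σ.SameCycle a z) h (Or.inl rfl) ?_
    rintro z (rfl | hz)
    · rw [hba]; exact Or.inr (Equiv.Perm.SameCycle.refl _ _)
    · rw [Equiv.Perm.mul_apply, Equiv.swap_apply_def]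
      split_ifs
      · exact Or.inr (Equiv.Perm.SameCycle.refl _ _)
      · exact Or.inl rfl
      · exact Or.inr (Equiv.Perm.sameCycle_apply_right.mpr hz)
  · have ha : (Equiv.swap b a * σ).SameCycle b a := by
      have := Equiv.Perm.sameCycle_apply_right.mpr
        (Equiv.Perm.SameCycle.refl (Equiv.swap b a * σ) b)
      rwa [hba] at this
    rintro (rfl | h)
    · exact Equiv.Perm.SameCycle.refl _ _
    · refine sameCycle_induction (P := fun z => (Equiv.swap b a * σ).SameCycle b z) h ha ?_
      intro z hz
      have h2 := Equiv.Perm.sameCycle_apply_right.mpr hz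
      rw [Equiv.Perm.mul_apply, Equiv.swap_apply_def] at h2
      split_ifs at h2 with h3 h4
      · rw [h3]
      · rw [h4]; exact ha
      · exact h2

theorem not_sameCycle_of_fixed {σ : Equiv.Perm (Fin n)} {a b : Fin n} (hb : σ b = b)
    (hab : a ≠ b) : ¬ σ.SameCycle a b := fun h =>
  hab (sameCycle_induction (P := (· = b)) h.symm rfl (by rintro z rfl; exact hb))

theorem cycleLen_swap_mul {σ : Equiv.Perm (Fin n)} {a b : Fin n} (hb : σ b = b) (hab : a ≠ b) :
    cycleLen (Equiv.swap b a * σ) b = cycleLen σ a + 1 := by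
  rw [cycleLen, cycleLen, ← Finset.card_insert_of_notMem (a := b)]
  · congr 1
    ext z
    simp [sameCycle_swap_mul hb]
  · simpa using not_sameCycle_of_fixed hb hab

theorem cycleEntry_swap_mul {σ : Equiv.Perm (Fin n)} {a b : Fin n} (hb : σ b = b) (hab : a ≠ b)
    {i : ℕ} (hi : i < cycleLen σ a) :
    cycleEntry (Equiv.swap b a * σ) b (i + 1) = cycleEntry σ a i := by
  induction i with
  | zero => simp [cycleEntry, hb]
  | succ i ih =>
    have e := ih (Nat.lt_of_succ_lt hi)
    have h1 := cycleEntry_ne σ a (Nat.succ_pos i) hi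
    simp only [cycleEntry, pow_zero, Equiv.Perm.one_apply] at e h1 ⊢
    rw [pow_succ', Equiv.Perm.mul_apply, e, swap_mul_apply_of_ne hb, pow_succ',
      Equiv.Perm.mul_apply]
    · intro h
      exact not_sameCycle_of_fixed hb hab (h ▸ sameCycle_cycleEntry σ a i)
    · rw [← Equiv.Perm.mul_apply, ← pow_succ']
      exact h1.symm

/-- Outside of the cycle of `b`, the permutations `swap b a * σ` and `σ` agree. -/
theorem swap_mul_agree {σ : Equiv.Perm (Fin n)} {a b : Fin n} (hb : σ b = b) :
    (∀ z, (z ≠ b ∧ ¬ σ.SameCycle a z) → σ z ≠ b ∧ ¬ σ.SameCycle a (σ z)) ∧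
      ∀ z, (z ≠ b ∧ ¬ σ.SameCycle a z) → (Equiv.swap b a * σ) z = σ z := by
  refine ⟨fun z hz => ⟨fun h => hz.1 (σ.injective (h.trans hb.symm)), fun h =>
    hz.2 (Equiv.Perm.sameCycle_apply_right.mp h)⟩, fun z hz => swap_mul_apply_of_ne hb hz.1 ?_⟩
  intro h
  exact hz.2 (Equiv.Perm.sameCycle_apply_right.mp (by rw [h]))

end Cycles

/-! ### The weight of a single word -/

section PathWeight

variable {A : Type*} [CommRing A] {α : Type*} [LinearOrder α]

/-- The weight of the word `c 0, ..., c k`: it is `y` to the number of descents if there are no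
two consecutive ascents (and, if `asc` holds, no ascent at the beginning), and `0` otherwise. -/
def pathWeight (y : A) (asc : Bool) : ℕ → (ℕ → α) → A
  | 0, _ => 1
  | k + 1, c =>
    if c 1 < c 0 then y * pathWeight y false k fun i => c (i + 1)
    else if asc then 0 else pathWeight y true k fun i => c (i + 1)

theorem pathWeight_congr (y : A) (asc : Bool) (k : ℕ) (c d : ℕ → α) (h : ∀ i ≤ k, c i = d i) :
    pathWeight y asc k c = pathWeight y asc k d := by
  induction k generalizing c d asc with
  | zero => rfl
  | succ k ih =>
    have e (asc) := ih asc (fun i => c (i + 1)) (fun i => d (i + 1)) fun i hi => h _ (by omega)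
    rw [pathWeight, pathWeight, h 0 (by omega), h 1 (by omega), e, e]

-- Neighbouring letters differ, so a step that is not a descent is an ascent. After an initial
-- ascent, avoiding a double ascent at the start is the condition that `asc = true` puts on the
-- tail.
open Classical in
theorem pathWeight_eq (y : A) (asc : Bool) (k : ℕ) (c : ℕ → α) (hc : ∀ i < k, c i ≠ c (i + 1)) :
    pathWeight y asc k c =
      if (asc = true → 0 < k → c 1 < c 0) ∧
          ¬ ∃ r, r + 2 ≤ k ∧ c r < c (r + 1) ∧ c (r + 1) < c (r + 2)
      then y ^ ((Finset.range k).filter fun r => c (r + 1) < c r).card else 0 := by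
  induction k generalizing c asc with
  | zero => simp [pathWeight]
  | succ k ih =>
    have e (asc) := ih asc (fun i => c (i + 1)) fun i hi => hc _ (by omega)
    have hcard : ((Finset.range (k + 1)).filter fun r => c (r + 1) < c r).card =
        (if c 1 < c 0 then 1 else 0) +
          ((Finset.range k).filter fun r => c (r + 1 + 1) < c (r + 1)).card := by
      rw [Finset.card_filter, Finset.sum_range_succ', Finset.card_filter, add_comm]
    have hex : (∃ r, r + 2 ≤ k + 1 ∧ c r < c (r + 1) ∧ c (r + 1) < c (r + 2)) ↔
        (0 < k ∧ c 0 < c 1 ∧ c 1 < c 2) ∨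
          ∃ r, r + 2 ≤ k ∧ c (r + 1) < c (r + 1 + 1) ∧ c (r + 1 + 1) < c (r + 2 + 1) := by
      constructor
      · rintro ⟨_ | r, h, h'⟩
        · exact Or.inl ⟨by omega, h'⟩
        · exact Or.inr ⟨r, by omega, h'⟩
      · rintro (⟨h, h'⟩ | ⟨r, h, h'⟩)
        · exact ⟨0, by omega, h'⟩
        · exact ⟨r + 1, by omega, h'⟩
    rw [pathWeight, e, e, hcard, hex]
    by_cases h01 : c 1 < c 0
    · simp only [h01, if_true, not_lt_of_gt h01]
      simp [pow_add]
    · have h10 : c 0 < c 1 := lt_of_le_of_ne (not_lt.mp h01) (hc 0 (by omega))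
      have h12 : 0 < k → (¬ c 1 < c 2 ↔ c 2 < c 1) := fun hk =>
        ⟨fun h => lt_of_le_of_ne (not_lt.mp h) (hc 1 (by omega)).symm, not_lt_of_gt⟩
      cases asc with
      | true => simp [h01]
      | false =>
        simp only [h01, h10, if_false, Bool.false_eq_true, true_and, zero_add]
        simp only [forall_const, not_or, not_and, false_imp_iff, true_and]
        congr 1
        apply propext
        refine and_congr_left' ?_
        exact forall_congr' fun hk => (h12 hk).symm

end PathWeight

/-! ### Summing over permutations by splitting off one cycle -/

section PermSum

variable {n : ℕ} {A : Type*} [CommRing A]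

/-- The weight of the cycle of `b`, read as a word that begins with `b`. -/
def cycleWeight (y : A) (σ : Equiv.Perm (Fin n)) (asc : Bool) (b : Fin n) : A :=
  pathWeight y asc (cycleLen σ b - 1) (cycleEntry σ b)

/-- The permutations that fix all elements outside of `S`. -/
def permsIn (S : Finset (Fin n)) : Finset (Equiv.Perm (Fin n)) :=
  Finset.univ.filter fun σ => ∀ z, z ∉ S → σ z = z

theorem mem_permsIn {S : Finset (Fin n)} {σ : Equiv.Perm (Fin n)} :
    σ ∈ permsIn S ↔ ∀ z, z ∉ S → σ z = z := by
  simp [permsIn]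

/-- The weighted sum over the permutations of `S`. -/
def permSum (x y : A) (S : Finset (Fin n)) : A :=
  ∑ σ ∈ permsIn S, ∏ k ∈ S.filter (· ∈ cycleMins σ), (x * y * cycleWeight y σ false k)

/-- The product of the weights of the cycles in `S` that do not contain `b`. -/
def otherCycles (x y : A) (S : Finset (Fin n)) (b : Fin n) (σ : Equiv.Perm (Fin n)) : A :=
  ∏ k ∈ S.filter (fun k => k ∈ cycleMins σ ∧ ¬ σ.SameCycle b k),
    (x * y * cycleWeight y σ false k)

theorem cycleWeight_of_fixed (y : A) {σ : Equiv.Perm (Fin n)} {b : Fin n} (hb : σ b = b)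
    (asc : Bool) : cycleWeight y σ asc b = 1 := by
  have h : cycleLen σ b = 1 := by
    rw [cycleLen_eq_minimalPeriod]
    exact Function.minimalPeriod_eq_one_iff_isFixedPt.mpr hb
  rw [cycleWeight, h, Nat.sub_self, pathWeight]

theorem cycleWeight_swap_mul (y : A) {σ : Equiv.Perm (Fin n)} {a b : Fin n} (hb : σ b = b)
    (hab : a ≠ b) (asc : Bool) :
    cycleWeight y (Equiv.swap b a * σ) asc b =
      if a < b then y * cycleWeight y σ false a else if asc then 0 else cycleWeight y σ true a := by
  obtain ⟨k, hk⟩ := Nat.exists_eq_succ_of_ne_zero (cycleLen_pos σ a).ne'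
  have e (asc) : pathWeight y asc k (fun i => cycleEntry (Equiv.swap b a * σ) b (i + 1)) =
      pathWeight y asc k (cycleEntry σ a) :=
    pathWeight_congr y asc k _ _ fun i hi => cycleEntry_swap_mul hb hab (by omega)
  have h0 : cycleEntry (Equiv.swap b a * σ) b 0 = b := rfl
  have h1 : cycleEntry (Equiv.swap b a * σ) b 1 = a :=
    cycleEntry_swap_mul hb hab (cycleLen_pos σ a)
  rw [cycleWeight, cycleWeight, cycleWeight, cycleLen_swap_mul hb hab, hk, Nat.succ_eq_add_one,
    Nat.add_sub_cancel, Nat.add_sub_cancel, pathWeight, h0, h1, e, e]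

theorem cycleWeight_eq_of_invariant (y : A) {σ τ : Equiv.Perm (Fin n)} {P : Fin n → Prop}
    (hσ : ∀ z, P z → P (σ z)) (hτ : ∀ z, P z → τ z = σ z) {a : Fin n} (ha : P a) (asc : Bool) :
    cycleWeight y τ asc a = cycleWeight y σ asc a := by
  have h : cycleLen τ a = cycleLen σ a := by
    simp only [cycleLen, sameCycle_iff_of_invariant hσ hτ ha]
  have h1 : cycleEntry τ a = cycleEntry σ a :=
    funext fun i => (pow_apply_eq_of_invariant hσ hτ ha i).2
  rw [cycleWeight, cycleWeight, h, h1]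

theorem mem_cycleMins {σ : Equiv.Perm (Fin n)} {m : Fin n} :
    m ∈ cycleMins σ ↔ ∀ a, σ.SameCycle m a → m ≤ a := by
  simp [cycleMins]

theorem otherCycles_swap_mul (x y : A) {S : Finset (Fin n)} {σ : Equiv.Perm (Fin n)} {a b : Fin n}
    (hb : σ b = b) (hbS : b ∉ S) :
    otherCycles x y S b (Equiv.swap b a * σ) = otherCycles x y (S.erase a) a σ := by
  obtain ⟨h1, h2⟩ := swap_mul_agree (a := a) hb
  rw [otherCycles, otherCycles]
  have e : S.filter (fun k => k ∈ cycleMins (Equiv.swap b a * σ) ∧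
      ¬ (Equiv.swap b a * σ).SameCycle b k) =
      (S.erase a).filter fun k => k ∈ cycleMins σ ∧ ¬ σ.SameCycle a k := by
    ext k
    simp only [Finset.mem_filter, Finset.mem_erase, sameCycle_swap_mul hb, mem_cycleMins, not_or]
    have key (hk : k ≠ b ∧ ¬ σ.SameCycle a k) :=
      sameCycle_iff_of_invariant h1 h2 (a := k) hk
    constructor
    · rintro ⟨hkS, hm, hk⟩
      refine ⟨⟨fun h => hk.2 (h ▸ Equiv.Perm.SameCycle.refl _ _), hkS⟩, fun z hz => ?_, hk.2⟩
      exact hm z ((key hk z).mpr hz)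
    · rintro ⟨⟨-, hkS⟩, hm, hk⟩
      have hk' : k ≠ b ∧ ¬ σ.SameCycle a k := ⟨fun h => hbS (h ▸ hkS), hk⟩
      exact ⟨hkS, fun z hz => hm z ((key hk' z).mp hz), hk'⟩
  rw [e]
  refine Finset.prod_congr rfl fun k hk => ?_
  simp only [Finset.mem_filter, Finset.mem_erase] at hk
  rw [cycleWeight_eq_of_invariant y h1 h2 ⟨fun h => hbS (h ▸ hk.1.2), hk.2.2⟩]

theorem otherCycles_of_fixed (x y : A) {S : Finset (Fin n)} {σ : Equiv.Perm (Fin n)} {b : Fin n}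
    (hb : σ b = b) (hbS : b ∉ S) :
    otherCycles x y S b σ =
      ∏ k ∈ S.filter (· ∈ cycleMins σ), (x * y * cycleWeight y σ false k) := by
  rw [otherCycles]
  congr 1
  refine Finset.filter_congr fun k hk => ?_
  have h : k ≠ b := fun h => hbS (h ▸ hk)
  exact and_iff_left fun hs => not_sameCycle_of_fixed hb h hs.symm

/-- A permutation of `insert b S` is determined by `a = σ b` and by the permutation of `S` obtained
when `b` is cut out of its cycle. The case `a = b` is that of a fixed point. -/
theorem sum_permsIn_insert {M : Type*} [AddCommMonoid M] {S : Finset (Fin n)} {b : Fin n}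
    (hbS : b ∉ S) (g : Equiv.Perm (Fin n) → M) :
    ∑ σ ∈ permsIn (insert b S), g σ =
      ∑ a ∈ insert b S, ∑ σ ∈ permsIn S, g (Equiv.swap b a * σ) := by
  rw [← Finset.sum_product']
  refine Finset.sum_bij' (fun σ _ => (σ b, Equiv.swap b (σ b) * σ))
    (fun p _ => Equiv.swap b p.1 * p.2) ?_ ?_ ?_ ?_ ?_
  · intro σ hσ
    rw [mem_permsIn] at hσ
    rw [Finset.mem_product, mem_permsIn]
    refine ⟨?_, fun z hz => ?_⟩
    · by_contra h
      exact h (by rw [σ.injective (hσ _ h)]; exact Finset.mem_insert_self _ _)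
    · rw [Equiv.Perm.mul_apply]
      by_cases hzb : z = b
      · rw [hzb, Equiv.swap_apply_right]
      · have hz' : z ∉ insert b S := by simp [hz, hzb]
        rw [hσ z hz']
        exact Equiv.swap_apply_of_ne_of_ne hzb fun h => hzb (σ.injective ((hσ z hz').trans h))
  · rintro ⟨a, σ⟩ h
    rw [Finset.mem_product, mem_permsIn] at h
    rw [mem_permsIn]
    intro z hz
    have hz' := Finset.mem_insert.not.mp hz
    rw [not_or] at hz'
    rw [Equiv.Perm.mul_apply, h.2 z hz'.2]
    exact Equiv.swap_apply_of_ne_of_ne hz'.1 fun hza => hz (hza ▸ h.1)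
  · intro σ _
    simp
  · rintro ⟨a, σ⟩ h
    rw [Finset.mem_product, mem_permsIn] at h
    simp [h.2 b hbS]
  · intro σ _
    simp

/-- Cutting `b` out makes its successor `a` the new head of the word, which is the recursion of
`pathSum`. Since `a` need not be the minimum of its cycle, the induction covers every head `b` and
both values of `asc`. -/
theorem sum_permsIn_eq_pathSum (x y : A) (S : Finset (Fin n)) (b : Fin n) (hbS : b ∉ S)
    (asc : Bool) :
    ∑ σ ∈ permsIn (insert b S), cycleWeight y σ asc b * otherCycles x y S b σ =
      pathSum y (permSum x y) S b asc := by
  induction S using Finset.strongInduction generalizing b asc with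
  | H S ih =>
    have hfix {σ : Equiv.Perm (Fin n)} (hσ : σ ∈ permsIn S) : σ b = b := mem_permsIn.mp hσ b hbS
    rw [sum_permsIn_insert hbS, Finset.sum_insert hbS, pathSum_eq, permSum]
    congr 1
    · refine Finset.sum_congr rfl fun σ hσ => ?_
      rw [Equiv.swap_self, ← Equiv.Perm.one_def, one_mul, cycleWeight_of_fixed y (hfix hσ),
        otherCycles_of_fixed x y (hfix hσ) hbS, one_mul]
    · refine Finset.sum_congr rfl fun a ha => ?_
      have hab : a ≠ b := fun h => hbS (h ▸ ha)
      have h := ih _ (Finset.erase_ssubset ha) a (Finset.notMem_erase a S)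
      rw [Finset.insert_erase ha] at h
      rw [pathStep, ← h, ← h, Finset.mul_sum]
      split_ifs with h1 h2
      · refine Finset.sum_congr rfl fun σ hσ => ?_
        rw [cycleWeight_swap_mul y (hfix hσ) hab, if_pos h1, mul_assoc,
          otherCycles_swap_mul x y (hfix hσ) hbS]
      · refine Finset.sum_eq_zero fun σ hσ => ?_
        rw [cycleWeight_swap_mul y (hfix hσ) hab, if_neg h1, if_pos h2, zero_mul]
      · refine Finset.sum_congr rfl fun σ hσ => ?_
        rw [cycleWeight_swap_mul y (hfix hσ) hab, if_neg h1, if_neg h2,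
          otherCycles_swap_mul x y (hfix hσ) hbS]

theorem permSum_empty (x y : A) : permSum x y (∅ : Finset (Fin n)) = 1 := by
  have h : permsIn (∅ : Finset (Fin n)) = {1} := by
    ext σ
    rw [mem_permsIn, Finset.mem_singleton]
    constructor
    · exact fun h => Equiv.ext fun z => h z (Finset.notMem_empty z)
    · rintro rfl z -
      rfl
  simp [permSum, h]

theorem permSum_eq_pathSum (x y : A) (S : Finset (Fin n)) (m : Fin n) (hm : m ∈ S)
    (hmin : ∀ z ∈ S.erase m, m < z) :
    permSum x y S = x * (y * pathSum y (permSum x y) (S.erase m) m false) := by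
  rw [← sum_permsIn_eq_pathSum x y _ m (Finset.notMem_erase m S), Finset.insert_erase hm,
    permSum, Finset.mul_sum, Finset.mul_sum]
  refine Finset.sum_congr rfl fun σ hσ => ?_
  have hσ' := mem_permsIn.mp hσ
  have hle : ∀ z ∈ S, m ≤ z := fun z hz => by
    by_cases h : z = m
    · exact h.ge
    · exact (hmin z (Finset.mem_erase.mpr ⟨h, hz⟩)).le
  have hclosed : ∀ z, z ∈ S → σ z ∈ S := fun z hz => by
    by_contra h
    exact h (by rwa [σ.injective (hσ' _ h)])
  have h1 : m ∈ cycleMins σ := mem_cycleMins.mpr fun z hz =>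
    hle z (sameCycle_induction (P := (· ∈ S)) hz hm hclosed)
  -- A cycle has only one minimum, so every cycle minimum other than `m` lies outside the cycle of
  -- `m`.
  have e : S.filter (· ∈ cycleMins σ) = insert m
      ((S.erase m).filter fun k => k ∈ cycleMins σ ∧ ¬ σ.SameCycle m k) := by
    ext k
    simp only [Finset.mem_filter, Finset.mem_insert, Finset.mem_erase]
    constructor
    · rintro ⟨hk, hkm⟩
      by_cases h : k = m
      · exact Or.inl h
      · refine Or.inr ⟨⟨h, hk⟩, hkm, fun hs => h ?_⟩
        exact le_antisymm (mem_cycleMins.mp hkm m hs.symm) (hle k hk)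
    · rintro (rfl | ⟨⟨-, hk⟩, hkm, -⟩)
      · exact ⟨hm, h1⟩
      · exact ⟨hk, hkm⟩
  rw [e, Finset.prod_insert (by simp), otherCycles]
  ring

/-- Taking out the minimum of `S` turns the inductive hypothesis into the coefficient of `x L G =
G'` at `#S - 1`, which is that of `G` at `#S`. -/
theorem permSum_eq_egfCoeff [Algebra ℚ A] (x y : A) {G : A⟦X⟧} (h0 : constantCoeff G = 1)
    (hG : derivative A G = C x * logDerivSeries y * G) (S : Finset (Fin n)) :
    permSum x y S = egfCoeff G S.card := by
  induction S using Finset.strongInduction with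
  | H S ih =>
    rcases S.eq_empty_or_nonempty with rfl | hS
    · rw [permSum_empty, Finset.card_empty, egfCoeff_zero, h0]
    have hm := S.min'_mem hS
    have hmin : ∀ z ∈ S.erase (S.min' hS), S.min' hS < z := fun z hz =>
      S.min'_lt_of_mem_erase_min' hS hz
    rw [permSum_eq_pathSum x y S _ hm hmin, pathSum_congr y (v := fun T => egfCoeff G T.card),
      mul_pathSum_egfCoeff y G _ _ hmin, ← egfCoeff_C_mul, ← mul_assoc, ← hG,
      egfCoeff_derivative, Finset.card_erase_add_one hm]
    exact fun T hT => ih T (hT.trans_ssubset (Finset.erase_ssubset hm))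

end PermSum

/-! ### From cycle matches to word weights -/

section CycleMatch

variable {n : ℕ}

theorem redEq_pattern123 (w : Fin 3 → Fin n) :
    RedEq w pattern123 ↔ w 0 < w 1 ∧ w 1 < w 2 := by
  constructor
  · intro h
    exact ⟨(h 0 1).mpr (by decide), (h 1 2).mpr (by decide)⟩
  · rintro ⟨h1, h2⟩
    have hw : StrictMono w := by
      rw [Fin.strictMono_iff_lt_succ]
      intro i
      fin_cases i
      · exact h1
      · exact h2
    exact fun a b => hw.lt_iff_lt

/-- A match of `123` does not wrap around the end of a cycle that begins with its minimum. -/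
theorem hasCycleMatch_pattern123 (σ : Equiv.Perm (Fin n)) :
    HasCycleMatch pattern123 σ ↔ ∃ m ∈ cycleMins σ, ∃ r, r + 2 ≤ cycleLen σ m - 1 ∧
      cycleEntry σ m r < cycleEntry σ m (r + 1) ∧
        cycleEntry σ m (r + 1) < cycleEntry σ m (r + 2) := by
  refine exists_congr fun m => and_congr_right fun hm => ?_
  have hle (i : ℕ) : m ≤ cycleEntry σ m i := mem_cycleMins.mp hm _ (sameCycle_cycleEntry σ m i)
  constructor
  · rintro ⟨-, r, hr, h⟩
    rw [redEq_pattern123] at h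
    obtain ⟨h1, h2⟩ := h
    simp only [Fin.val_zero, Fin.val_one, Fin.val_two, add_zero] at h1 h2
    refine ⟨r, ?_, h1, h2⟩
    rw [Finset.mem_range] at hr
    by_contra hlt
    have hp := cycleEntry_cycleLen σ m
    -- A wrapping match would have an ascent ending at the index of the cycle length, where the
    -- entry is again the minimum `m`.
    have h3 : r + 1 = cycleLen σ m ∨ r + 2 = cycleLen σ m := by omega
    rcases h3 with h3 | h3
    · rw [h3, hp] at h1
      exact absurd (hle r) (not_le.mpr h1)
    · rw [h3, hp] at h2
      exact absurd (hle (r + 1)) (not_le.mpr h2)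
  · rintro ⟨r, hr, h⟩
    exact ⟨by omega, r, Finset.mem_range.mpr (by omega), (redEq_pattern123 _).mpr h⟩

variable {A : Type*} [CommRing A]

theorem prod_cycleWeight (x y : A) (σ : Equiv.Perm (Fin n)) :
    ∏ m ∈ cycleMins σ, (x * y * cycleWeight y σ false m) =
      if HasCycleMatch pattern123 σ then 0 else x ^ cyc σ * y ^ cdes σ := by
  have e (m : Fin n) := pathWeight_eq y false (cycleLen σ m - 1) (cycleEntry σ m) fun i hi =>
    cycleEntry_ne σ m (Nat.lt_succ_self i) (by omega)
  split_ifs with h <;> rw [hasCycleMatch_pattern123] at h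
  · obtain ⟨m, hm, hr⟩ := h
    refine Finset.prod_eq_zero hm ?_
    rw [cycleWeight, e, if_neg fun h => h.2 hr, mul_zero]
  · rw [cyc, cdes, ← Finset.prod_pow_eq_pow_sum, ← Finset.prod_const, ← Finset.prod_mul_distrib]
    refine Finset.prod_congr rfl fun m hm => ?_
    rw [cycleWeight, e, if_pos ⟨fun h => absurd h Bool.false_ne_true, fun hr => h ⟨m, hm, hr⟩⟩,
      cycleCdes, pow_add, pow_one, mul_assoc]

theorem permSum_univ (x y : A) :
    permSum x y (Finset.univ : Finset (Fin n)) =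
      ∑ σ ∈ NCMS n pattern123, x ^ cyc σ * y ^ cdes σ := by
  have h : permsIn (Finset.univ : Finset (Fin n)) = Finset.univ := by
    ext σ
    simp [mem_permsIn]
  rw [permSum, h, NCMS, Finset.sum_filter]
  refine Finset.sum_congr rfl fun σ _ => ?_
  rw [Finset.filter_univ_mem, prod_cycleWeight, ite_not]

theorem NCM_pattern123_eq [Algebra ℚ A] (x y : A) {G : A⟦X⟧} (h0 : constantCoeff G = 1)
    (hG : derivative A G = C x * logDerivSeries y * G) : NCM pattern123 x y = G := by
  apply egfCoeff_injective
  ext n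
  rw [NCM, egfCoeff_mk, ← permSum_univ, permSum_eq_egfCoeff x y h0 hG, Finset.card_univ,
    Fintype.card_fin]

end CycleMatch

end CycleMatch

theorem mainTheorem7 {A : Type*} [CommRing A] [Algebra ℚ A] (x y : A) :
    CycleMatch.NCM CycleMatch.pattern123 x y =
        CycleMatch.expOf
          (PowerSeries.C x *
            PowerSeries.logOf (PowerSeries.invOfUnit (CycleMatch.denomSeries y) 1)) ∧
      CycleMatch.NCM CycleMatch.pattern123 x y =
        CycleMatch.powOf (PowerSeries.invOfUnit (CycleMatch.denomSeries y) 1) x := by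
  have hr := CycleMatch.constantCoeff_recipSeries y
  refine ⟨CycleMatch.NCM_pattern123_eq x y ?_ (CycleMatch.derivative_expOf_log x y),
    CycleMatch.NCM_pattern123_eq x y ?_ (CycleMatch.derivative_powOf_recipSeries x y)⟩
  · exact CycleMatch.constantCoeff_expOf (by simp [PowerSeries.constantCoeff_logOf hr])
  · exact CycleMatch.constantCoeff_powOf hr x
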